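/- For $z\in\mathbb{C}$ and $C\in\mathbb{R}$ let $A(z,C)$ be the set of all $x\in\mathbb{Q}(i)$ such that $x=p/q$ for some coprime Gaussian integers $p,q\in\mathbb{Z}[i]$, $q\neq 0$, with $$\left|z-\frac{p}{q}\right|\le\frac{C}{|q|^2}.$$ Then for every $z\in\mathbb{C}\setminus\mathbb{Q}(i)$ the set $A(z,1/\sqrt{3})$ is infinite, and $1/\sqrt{3}$ is the smallest real number $C$ such that $A(z,C)$ is infinite for every $z\in\mathbb{C}\setminus\mathbb{Q}(i)$. The optimality is witnessed by $z_0=\frac{1+\sqrt{-3}}{2}$: one has $z_0\notin\mathbb{Q}(i)$, and $A(z_0,C)$ is finite for every real $C<1/\sqrt{3}$. -/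

import Mathlib

/-- The field `ℚ(i)` of Gaussian rationals, as a subfield of `ℂ`. -/
noncomputable def gaussianRationals : IntermediateField ℚ ℂ :=
  IntermediateField.adjoin ℚ {Complex.I}

/-- The Gaussian rationals `p / q`, with `p` and `q ≠ 0` coprime Gaussian integers,
such that `|z - p / q| ≤ C / |q| ^ 2`. It is a set of values `p / q`: multiplying `p` and `q` by a
common unit does not give a new element. -/
def goodApproximations (z : ℂ) (C : ℝ) : Set ℂ :=
  {x | ∃ p q : GaussianInt, q ≠ 0 ∧ IsCoprime p q ∧
    x = GaussianInt.toComplex p / GaussianInt.toComplex q ∧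
    ‖z - x‖ ≤ C / ‖GaussianInt.toComplex q‖ ^ 2}

open Complex in
theorem mem_gaussianRationals_iff {x : ℂ} :
    x ∈ gaussianRationals ↔ ∃ a b : ℚ, x = a + b * I := by
  constructor
  · intro hx
    induction hx using IntermediateField.adjoin_induction with
    | mem x hx => exact ⟨0, 1, by simpa using hx⟩
    | algebraMap x => exact ⟨x, 0, by simp⟩
    | add x y _ _ hx hy =>
      obtain ⟨a, b, rfl⟩ := hx
      obtain ⟨c, d, rfl⟩ := hy
      exact ⟨a + c, b + d, by push_cast; ring⟩
    | inv x _ hx =>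
      obtain ⟨a, b, rfl⟩ := hx
      refine ⟨a / (a * a + b * b), -b / (a * a + b * b), ?_⟩
      apply Complex.ext <;> simp [normSq_apply] <;> norm_cast <;> simp
    | mul x y _ _ hx hy =>
      obtain ⟨a, b, rfl⟩ := hx
      obtain ⟨c, d, rfl⟩ := hy
      refine ⟨a * c - b * d, a * d + b * c, ?_⟩
      push_cast
      linear_combination (b : ℂ) * d * I_mul_I
  · rintro ⟨a, b, rfl⟩
    have hI : I ∈ gaussianRationals := IntermediateField.mem_adjoin_simple_self ℚ I
    have hq (c : ℚ) : (c : ℂ) ∈ gaussianRationals := gaussianRationals.algebraMap_mem c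
    exact add_mem (hq a) (mul_mem (hq b) hI)

theorem toComplex_div_mem_gaussianRationals (p q : GaussianInt) :
    p.toComplex / q.toComplex ∈ gaussianRationals := by
  have h (r : GaussianInt) : r.toComplex ∈ gaussianRationals :=
    mem_gaussianRationals_iff.2 ⟨r.re, r.im, by simp [GaussianInt.toComplex_def]⟩
  exact div_mem (h p) (h q)

theorem finite_gaussianInt_norm_le (R : ℝ) : {q : GaussianInt | ‖q.toComplex‖ ≤ R}.Finite := by
  have hinj : Function.Injective fun q : GaussianInt => (q.re, q.im) := fun a b h =>
    Zsqrtd.ext (congrArg Prod.fst h) (congrArg Prod.snd h)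
  refine Set.Finite.of_finite_image (f := fun q : GaussianInt => (q.re, q.im)) ?_ hinj.injOn
  refine ((Set.finite_Icc (-⌈R⌉) ⌈R⌉).prod (Set.finite_Icc (-⌈R⌉) ⌈R⌉)).subset ?_
  rintro _ ⟨q, hq, rfl⟩
  have key (n : ℤ) (h : |(n : ℝ)| ≤ ‖q.toComplex‖) : n ∈ Set.Icc (-⌈R⌉) ⌈R⌉ := by
    have h1 : |(n : ℝ)| ≤ ⌈R⌉ := (h.trans hq).trans (Int.le_ceil R)
    rw [abs_le] at h1
    exact ⟨by exact_mod_cast h1.1, by exact_mod_cast h1.2⟩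
  exact ⟨key _ (by simpa using Complex.abs_re_le_norm q.toComplex),
    key _ (by simpa using Complex.abs_im_le_norm q.toComplex)⟩

theorem one_le_norm_toComplex {q : GaussianInt} (hq : q ≠ 0) : 1 ≤ ‖q.toComplex‖ := by
  have h : 0 < q.norm := GaussianInt.norm_pos.2 hq
  have h1 : (1 : ℝ) ≤ q.norm := by exact_mod_cast h
  rw [GaussianInt.intCast_real_norm, Complex.normSq_eq_norm_sq] at h1
  nlinarith [norm_nonneg q.toComplex]

theorem sixthRoot_notMem_gaussianRationals :
    (1 + (Real.sqrt 3 : ℂ) * Complex.I) / 2 ∉ gaussianRationals := by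
  rw [mem_gaussianRationals_iff]
  rintro ⟨a, b, h⟩
  have h2 := congrArg Complex.im h
  simp at h2
  have h3 : Irrational √3 := Nat.Prime.irrational_sqrt (by norm_num : Nat.Prime 3)
  exact h3 ⟨2 * b, by push_cast; linarith⟩

theorem finite_goodApproximations_sixthRoot {C : ℝ} (hC : C < 1 / Real.sqrt 3) :
    (goodApproximations ((1 + (Real.sqrt 3 : ℂ) * Complex.I) / 2) C).Finite := by
  set z : ℂ := (1 + (Real.sqrt 3 : ℂ) * Complex.I) / 2 with hz
  have hs : 0 < √3 := by positivity
  have hs2 : √3 ^ 2 = 3 := Real.sq_sqrt (by norm_num)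
  have hsC : (√3 : ℂ) ^ 2 = 3 := by exact_mod_cast hs2
  have hC1 : 0 < 1 - C * √3 := by rw [lt_div_iff₀ hs] at hC; linarith
  set R : ℝ := C ^ 2 / (1 - C * √3) with hR
  have hfin := (finite_gaussianInt_norm_le ((R + 1) * (‖z‖ + C))).prod
    (finite_gaussianInt_norm_le (R + 1))
  refine (hfin.image fun w => w.1.toComplex / w.2.toComplex).subset ?_
  rintro _ ⟨p, q, hq, -, rfl, hle⟩
  refine ⟨(p, q), ?_, rfl⟩
  have hn1 := one_le_norm_toComplex hq
  set n := ‖q.toComplex‖ with hn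
  have hn0 : 0 < n := by linarith
  have hq0 : q.toComplex ≠ 0 := norm_pos_iff.1 hn0
  have hC0 : 0 ≤ C := by
    by_contra! h
    have := div_neg_of_neg_of_pos h (pow_pos hn0 2)
    linarith [norm_nonneg (z - p.toComplex / q.toComplex)]
  set x := p.toComplex / q.toComplex with hx
  have hpx : p.toComplex = x * q.toComplex := by rw [hx]; field_simp
  have hprod : (p ^ 2 - p * q + q ^ 2).toComplex = q.toComplex ^ 2 * ((z - x) * (1 - z - x)) := by
    simp only [map_add, map_sub, map_pow, map_mul, hpx, hz]
    linear_combination (q.toComplex ^ 2 / 4) * (hsC * Complex.I ^ 2 + 3 * Complex.I_sq)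
  have hzmem := sixthRoot_notMem_gaussianRationals
  have hxmem : x ∈ gaussianRationals := toComplex_div_mem_gaussianRationals p q
  have hne : p ^ 2 - p * q + q ^ 2 ≠ 0 := by
    intro h
    rw [h, map_zero, eq_comm] at hprod
    have h1 : (z - x) * (1 - z - x) = 0 := by simpa [hq0] using hprod
    rcases mul_eq_zero.1 h1 with h1 | h1
    · exact hzmem (by rw [← hz, sub_eq_zero.1 h1]; exact hxmem)
    · refine hzmem ?_
      rw [← hz, show z = 1 - x by linear_combination -h1]
      exact sub_mem (one_mem _) hxmem
  have h1 := one_le_norm_toComplex hne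
  rw [hprod, norm_mul, norm_mul, norm_pow, ← hn] at h1
  have h2 : ‖1 - z - x‖ ≤ ‖z - x‖ + √3 := by
    have : 1 - z - x = (z - x) - (√3 : ℂ) * Complex.I := by rw [hz]; ring
    rw [this]
    refine (norm_sub_le _ _).trans ?_
    simp [abs_of_pos hs]
  have h3 : n ^ 2 * ‖z - x‖ ≤ C := by
    rw [le_div_iff₀ (by positivity)] at hle; linarith
  have h4 : 1 ≤ C * (‖z - x‖ + √3) := by
    calc 1 ≤ (n ^ 2 * ‖z - x‖) * ‖1 - z - x‖ := by linarith
      _ ≤ C * (‖z - x‖ + √3) := by gcongr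
  have h5 : n ^ 2 * (1 - C * √3) ≤ C ^ 2 := by nlinarith
  have h6 : n ^ 2 ≤ R := by rwa [hR, le_div_iff₀ hC1]
  have h7 : n ≤ R + 1 := by nlinarith
  have h8 : ‖z - x‖ ≤ C := by
    nlinarith [mul_nonneg (by nlinarith : 0 ≤ n ^ 2 - 1) (norm_nonneg (z - x))]
  refine ⟨?_, h7⟩
  have h9 : ‖x‖ ≤ ‖z‖ + C := by
    have := norm_sub_norm_le x z
    rw [norm_sub_rev] at this
    linarith
  change ‖p.toComplex‖ ≤ _
  rw [hpx, norm_mul, ← hn, mul_comm]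
  gcongr

theorem exists_le_two_div_sqrt_three_of_sum_eq {x y w : ℝ} (hx : 0 ≤ x) (hy : 0 ≤ y) (hw : 0 ≤ w)
    (h : x * y + y * w + w * x = 1) :
    x + y ≤ 2 / √3 ∨ y + w ≤ 2 / √3 ∨ w + x ≤ 2 / √3 := by
  have key (a b c : ℝ) (ha : 0 ≤ a) (hb : 0 ≤ b) (hac : a ≤ c) (hbc : b ≤ c)
      (habc : a * b + b * c + c * a = 1) : a + b ≤ 2 / √3 := by
    rw [le_div_iff₀ (by positivity)]
    have h3 : √3 ^ 2 = 3 := Real.sq_sqrt (by norm_num)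
    refine abs_le_of_sq_le_sq' ?_ (by norm_num) |>.2
    rw [mul_pow, h3]
    rcases le_total a b with hab | hab <;> nlinarith
  rcases le_total x y with h1 | h1 <;> rcases le_total y w with h2 | h2 <;>
    rcases le_total x w with h3 | h3
  all_goals first
    | exact Or.inl (key x y w hx hy (by linarith) (by linarith) h)
    | exact Or.inr (Or.inl (key y w x hy hw (by linarith) (by linarith) (by linarith)))
    | exact Or.inr (Or.inr (key w x y hw hx (by linarith) (by linarith) (by linarith)))

/-- A point on the boundary of the octahedron `|X| + |Y| + |Z| ≤ N`. -/
theorem exists_sub_abs_le_of_eq {N X Y Z : ℝ} (h : N ^ 2 - X ^ 2 - Y ^ 2 - Z ^ 2 = 2)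
    (hN : N = |X| + |Y| + |Z|) :
    N - |X| ≤ 2 / √3 ∨ N - |Y| ≤ 2 / √3 ∨ N - |Z| ≤ 2 / √3 := by
  have h1 : |X| * |Y| + |Y| * |Z| + |Z| * |X| = 1 := by
    rw [← sq_abs X, ← sq_abs Y, ← sq_abs Z, hN] at h
    linarith
  rcases exists_le_two_div_sqrt_three_of_sum_eq (abs_nonneg X) (abs_nonneg Y) (abs_nonneg Z) h1
    with h2 | h2 | h2
  · exact Or.inr (Or.inr (by linarith))
  · exact Or.inl (by linarith)
  · exact Or.inr (Or.inl (by linarith))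

/-- A point of the octahedron `|X| + |Y| + |Z| ≤ N`. -/
theorem exists_sub_abs_le_two {N X Y Z : ℝ} (h : N ^ 2 - X ^ 2 - Y ^ 2 - Z ^ 2 = 2)
    (hN : |X| + |Y| + |Z| ≤ N) : N - |X| ≤ 2 ∨ N - |Y| ≤ 2 ∨ N - |Z| ≤ 2 := by
  by_contra! hcon
  obtain ⟨h1, h2, h3⟩ := hcon
  rw [← sq_abs X, ← sq_abs Y, ← sq_abs Z] at h
  have hX := abs_nonneg X
  have hY := abs_nonneg Y
  have hZ := abs_nonneg Z
  nlinarith [mul_nonneg hX (by linarith : 0 ≤ N - |X| - 2),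
    mul_nonneg hY (by linarith : 0 ≤ N - |Y| - 2), mul_nonneg hZ (by linarith : 0 ≤ N - |Z| - 2)]

open ComplexConjugate

/-- The positive definite Hermitian form attached to the point of height `t` above `z` in
hyperbolic space. -/
noncomputable def heightForm (z : ℂ) (t : ℝ) (p q : GaussianInt) : ℝ :=
  Complex.normSq (p.toComplex - q.toComplex * z) / t + t * Complex.normSq q.toComplex

/-- The sesquilinear pairing of `heightForm`. -/
noncomputable def heightPairing (z : ℂ) (t : ℝ) (p q p' q' : GaussianInt) : ℂ :=
  (p.toComplex - q.toComplex * z) * conj (p'.toComplex - q'.toComplex * z) / t +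
    t * (q.toComplex * conj q'.toComplex)

theorem heightPairing_conj (z : ℂ) (t : ℝ) (p q p' q' : GaussianInt) :
    conj (heightPairing z t p q p' q') = heightPairing z t p' q' p q := by
  simp only [heightPairing, map_add, map_mul, map_div₀, Complex.conj_conj, Complex.conj_ofReal]
  ring

theorem heightPairing_self (z : ℂ) (t : ℝ) (p q : GaussianInt) :
    heightPairing z t p q p q = heightForm z t p q := by
  simp only [heightPairing, heightForm, Complex.mul_conj]
  push_cast
  rfl

theorem heightPairing_sub_mul (z : ℂ) (t : ℝ) (k p q p' q' : GaussianInt) :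
    heightPairing z t (p' - k * p) (q' - k * q) p q =
      heightPairing z t p' q' p q - k.toComplex * heightForm z t p q := by
  rw [← heightPairing_self]
  simp only [heightPairing, map_sub, map_mul]
  ring

theorem heightForm_mul_sub (z : ℂ) (t : ℝ) (k p q p' q' : GaussianInt) :
    heightForm z t (k * p - p') (k * q - q') =
      Complex.normSq k.toComplex * heightForm z t p q
        - 2 * (conj k.toComplex * heightPairing z t p' q' p q).re + heightForm z t p' q' := by
  have h1 : ((2 * (conj k.toComplex * heightPairing z t p' q' p q).re : ℝ) : ℂ) =
      conj k.toComplex * heightPairing z t p' q' p q +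
        k.toComplex * heightPairing z t p q p' q' := by
    rw [← heightPairing_conj z t p' q', Complex.ofReal_mul, Complex.re_eq_add_conj, map_mul,
      Complex.conj_conj]
    push_cast
    ring
  apply Complex.ofReal_injective
  rw [Complex.ofReal_add, Complex.ofReal_sub, h1, Complex.ofReal_mul, ← Complex.mul_conj]
  simp only [← heightPairing_self]
  simp only [heightPairing, map_sub, map_mul]
  ring

theorem heightForm_mul_heightForm {z : ℂ} {t : ℝ} (ht : t ≠ 0) {p q p' q' : GaussianInt}
    (h : p * q' - p' * q = 1) :
    heightForm z t p q * heightForm z t p' q' - (heightPairing z t p' q' p q).re ^ 2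
      - (heightPairing z t p' q' p q).im ^ 2 = 1 := by
  have h0 : (p.toComplex - q.toComplex * z) * q'.toComplex
      - (p'.toComplex - q'.toComplex * z) * q.toComplex = 1 := by
    have := congrArg GaussianInt.toComplex h
    simp only [map_sub, map_mul, map_one] at this
    linear_combination this
  have h0' := congrArg conj h0
  simp only [map_sub, map_mul, map_one] at h0'
  have h1 : (heightPairing z t p' q' p q).re ^ 2 + (heightPairing z t p' q' p q).im ^ 2 =
      Complex.normSq (heightPairing z t p' q' p q) := by rw [Complex.normSq_apply]; ring
  have ht' : (t : ℂ) ≠ 0 := by exact_mod_cast ht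
  rw [sub_sub, h1]
  apply Complex.ofReal_injective
  rw [Complex.ofReal_sub, Complex.ofReal_mul, ← Complex.mul_conj, heightPairing_conj]
  simp only [← heightPairing_self]
  simp only [heightPairing, map_sub, map_mul, Complex.ofReal_one]
  rw [← mul_one (1 : ℂ)]
  nth_rewrite 1 [← h0]
  rw [← h0']
  field_simp
  ring

theorem isCoprime_linearCombination {p q p' q' P Q : GaussianInt} (h : p * q' - p' * q = 1)
    (hPQ : IsCoprime P Q) : IsCoprime (P * p + Q * p') (P * q + Q * q') := by
  obtain ⟨α, β, hαβ⟩ := hPQ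
  exact ⟨α * q' - β * q, β * p - α * p', by linear_combination h * (α * P + β * Q) + hαβ⟩

theorem finite_heightForm_le (z : ℂ) {t : ℝ} (ht : 0 < t) (R : ℝ) :
    {w : GaussianInt × GaussianInt | heightForm z t w.1 w.2 ≤ R}.Finite := by
  refine ((finite_gaussianInt_norm_le (R * t + 1 + (R / t + 1) * ‖z‖)).prod
    (finite_gaussianInt_norm_le (R / t + 1))).subset ?_
  rintro ⟨p, q⟩ h
  simp only [Set.mem_ofPred_eq, heightForm, Complex.normSq_eq_norm_sq] at h
  have h1 : 0 ≤ ‖p.toComplex - q.toComplex * z‖ ^ 2 / t := by positivity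
  have h2 : 0 ≤ t * ‖q.toComplex‖ ^ 2 := by positivity
  have h3 : ‖q.toComplex‖ ≤ R / t + 1 := by
    have : ‖q.toComplex‖ ^ 2 ≤ R / t := by rw [le_div_iff₀ ht]; linarith
    nlinarith [sq_nonneg (‖q.toComplex‖ - 1)]
  have h4 : ‖p.toComplex - q.toComplex * z‖ ≤ R * t + 1 := by
    have : ‖p.toComplex - q.toComplex * z‖ ^ 2 ≤ R * t := by rw [← div_le_iff₀ ht]; linarith
    nlinarith [sq_nonneg (‖p.toComplex - q.toComplex * z‖ - 1)]
  refine ⟨?_, h3⟩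
  calc ‖p.toComplex‖ = ‖(p.toComplex - q.toComplex * z) + q.toComplex * z‖ := by congr 1; ring
    _ ≤ ‖p.toComplex - q.toComplex * z‖ + ‖q.toComplex‖ * ‖z‖ := by
      rw [← norm_mul]; exact norm_add_le _ _
    _ ≤ R * t + 1 + (R / t + 1) * ‖z‖ := by gcongr

theorem exists_isCoprime_heightForm_le (z : ℂ) {t : ℝ} (ht : 0 < t) :
    ∃ p q : GaussianInt, IsCoprime p q ∧
      ∀ p' q' : GaussianInt, IsCoprime p' q' → heightForm z t p q ≤ heightForm z t p' q' := by
  obtain ⟨⟨p, q⟩, ⟨hpq, hle⟩, hmin⟩ := Set.exists_min_image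
    {w : GaussianInt × GaussianInt | IsCoprime w.1 w.2 ∧ heightForm z t w.1 w.2 ≤ heightForm z t 1 0}
    (fun w => heightForm z t w.1 w.2)
    ((finite_heightForm_le z ht _).subset fun w hw => hw.2) ⟨(1, 0), isCoprime_one_left, le_rfl⟩
  refine ⟨p, q, hpq, fun p' q' h => ?_⟩
  rcases le_total (heightForm z t p' q') (heightForm z t 1 0) with h1 | h1
  · exact hmin (p', q') ⟨h, h1⟩
  · exact hle.trans h1

/-- The cusps `∞, (1 + i) / 2, 0, 1 + i, 1, i` of the fundamental ideal octahedron, in the basis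
`(p, q), (p', q')`. -/
def octahedronVertices (p q p' q' : GaussianInt) : List (GaussianInt × GaussianInt) :=
  [(p, q), (⟨1, -1⟩ * p' - p, ⟨1, -1⟩ * q' - q), (p', q'), (⟨1, 1⟩ * p - p', ⟨1, 1⟩ * q - q'),
    (1 * p - p', 1 * q - q'), (⟨0, 1⟩ * p - p', ⟨0, 1⟩ * q - q')]

theorem isCoprime_of_mem_octahedronVertices {p q p' q' : GaussianInt} (h : p * q' - p' * q = 1)
    {w : GaussianInt × GaussianInt} (hw : w ∈ octahedronVertices p q p' q') :
    IsCoprime w.1 w.2 := by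
  have key (P Q : GaussianInt) (hPQ : IsCoprime P Q) (a b : GaussianInt) (ha : a = P * p + Q * p')
      (hb : b = P * q + Q * q') : IsCoprime a b := by
    subst ha hb
    exact isCoprime_linearCombination h hPQ
  simp only [octahedronVertices, List.mem_cons, List.not_mem_nil, or_false] at hw
  rcases hw with rfl | rfl | rfl | rfl | rfl | rfl
  · exact key 1 0 isCoprime_one_left _ _ (by ring) (by ring)
  · exact key (-1) ⟨1, -1⟩ isCoprime_one_left.neg_left _ _ (by ring) (by ring)
  · exact key 0 1 isCoprime_one_right _ _ (by ring) (by ring)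
  · exact key ⟨1, 1⟩ (-1) isCoprime_one_right.neg_right _ _ (by ring) (by ring)
  · exact key 1 (-1) isCoprime_one_left _ _ (by ring) (by ring)
  · exact key ⟨0, 1⟩ (-1) isCoprime_one_right.neg_right _ _ (by ring) (by ring)

/-- Nonnegative exactly when the point of height `t` above `z` lies in the ideal octahedron. -/
noncomputable def octahedronGap (z : ℂ) (t : ℝ) (p q p' q' : GaussianInt) : ℝ :=
  let A := heightForm z t p q
  let C := heightForm z t p' q'
  let b := (heightPairing z t p' q' p q).re
  let d := (heightPairing z t p' q' p q).im
  (A + C - b - d) - |C - b - d| - |A - b - d| - |b - d|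

theorem forall_octahedronVertices_lt {z : ℂ} {t r : ℝ} {p q p' q' : GaussianInt}
    (h : ∀ w ∈ octahedronVertices p q p' q', r < heightForm z t w.1 w.2) :
    let A := heightForm z t p q
    let C := heightForm z t p' q'
    let b := (heightPairing z t p' q' p q).re
    let d := (heightPairing z t p' q' p q).im
    r < (A + C - b - d) - |C - b - d| ∧ r < (A + C - b - d) - |A - b - d| ∧
      r < (A + C - b - d) - |b - d| := by
  intro A C b d
  simp only [octahedronVertices, List.mem_cons, List.not_mem_nil, or_false, forall_eq_or_imp,
    forall_eq, heightForm_mul_sub] at h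
  rw [← heightPairing_conj z t p' q' p q] at h
  simp [Complex.normSq_apply, GaussianInt.toComplex_def] at h
  obtain ⟨h1, h2, h3, h4, h5, h6⟩ := h
  refine ⟨lt_sub_comm.1 (abs_lt.2 ⟨?_, ?_⟩), lt_sub_comm.1 (abs_lt.2 ⟨?_, ?_⟩),
    lt_sub_comm.1 (abs_lt.2 ⟨?_, ?_⟩)⟩ <;> simp only [A, C, b, d] <;> linarith

theorem octahedronGap_ne_zero {z : ℂ} {t : ℝ} (ht : t ≠ 0) {p q p' q' : GaussianInt}
    (h : p * q' - p' * q = 1)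
    (hgt : ∀ w ∈ octahedronVertices p q p' q', 2 / √3 < heightForm z t w.1 w.2) :
    octahedronGap z t p q p' q' ≠ 0 := by
  intro h0
  obtain ⟨h1, h2, h3⟩ := forall_octahedronVertices_lt hgt
  have hdet := heightForm_mul_heightForm (z := z) ht h
  simp only [octahedronGap] at h0
  rcases exists_sub_abs_le_of_eq
      (N := heightForm z t p q + heightForm z t p' q'
        - (heightPairing z t p' q' p q).re - (heightPairing z t p' q' p q).im)
      (X := heightForm z t p' q' - (heightPairing z t p' q' p q).re
        - (heightPairing z t p' q' p q).im)
      (Y := heightForm z t p q - (heightPairing z t p' q' p q).re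
        - (heightPairing z t p' q' p q).im)
      (Z := (heightPairing z t p' q' p q).re - (heightPairing z t p' q' p q).im)
      (by linear_combination 2 * hdet) (by linear_combination h0) with
    h4 | h4 | h4 <;> linarith

theorem exists_octahedronVertices_le_two {z : ℂ} {t : ℝ} (ht : t ≠ 0) {p q p' q' : GaussianInt}
    (h : p * q' - p' * q = 1) (h0 : 0 ≤ octahedronGap z t p q p' q') :
    ∃ w ∈ octahedronVertices p q p' q', heightForm z t w.1 w.2 ≤ 2 := by
  by_contra! hgt
  obtain ⟨h1, h2, h3⟩ := forall_octahedronVertices_lt hgt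
  have hdet := heightForm_mul_heightForm (z := z) ht h
  simp only [octahedronGap] at h0
  rcases exists_sub_abs_le_two
      (N := heightForm z t p q + heightForm z t p' q'
        - (heightPairing z t p' q' p q).re - (heightPairing z t p' q' p q).im)
      (X := heightForm z t p' q' - (heightPairing z t p' q' p q).re
        - (heightPairing z t p' q' p q).im)
      (Y := heightForm z t p q - (heightPairing z t p' q' p q).re
        - (heightPairing z t p' q' p q).im)
      (Z := (heightPairing z t p' q' p q).re - (heightPairing z t p' q' p q).im)
      (by linear_combination 2 * hdet) (by linarith) with
    h4 | h4 | h4 <;> linarith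

theorem exists_octahedronGap_nonneg (z : ℂ) {t : ℝ} (ht : 0 < t) :
    ∃ p q p' q' : GaussianInt, p * q' - p' * q = 1 ∧ 0 ≤ octahedronGap z t p q p' q' := by
  obtain ⟨p, q, ⟨β, α, hαβ⟩, hmin⟩ := exists_isCoprime_heightForm_le z ht
  set A := heightForm z t p q with hA
  have hA0 : 0 < A := by
    have hdet := heightForm_mul_heightForm (z := z) ht.ne' (p := p) (q := q) (p' := -α) (q' := β)
      (by linear_combination hαβ)
    have h1 : 0 ≤ A := by 
      exact add_nonneg (div_nonneg (Complex.normSq_nonneg _) ht.le)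
        (mul_nonneg ht.le (Complex.normSq_nonneg _))
    refine h1.lt_of_ne fun h => ?_
    rw [← hA, ← h] at hdet
    nlinarith [sq_nonneg (heightPairing z t (-α) β p q).re,
      sq_nonneg (heightPairing z t (-α) β p q).im]
  set B := heightPairing z t (-α) β p q with hB
  set k : GaussianInt := ⟨⌊B.re / A⌋, ⌊B.im / A⌋⟩ with hk
  have hdet : p * (β - k * q) - (-α - k * p) * q = 1 := by linear_combination hαβ
  refine ⟨p, q, -α - k * p, β - k * q, hdet, ?_⟩
  have hB' := heightPairing_sub_mul z t k p q (-α) β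
  rw [← hA, ← hB] at hB'
  have hb := congrArg Complex.re hB'
  have hd := congrArg Complex.im hB'
  simp [hk, GaussianInt.toComplex_def] at hb hd
  have hv (w) (hw : w ∈ octahedronVertices p q (-α - k * p) (β - k * q)) :=
    hmin w.1 w.2 (isCoprime_of_mem_octahedronVertices hdet hw)
  simp only [octahedronVertices, List.mem_cons, List.not_mem_nil, or_false, forall_eq_or_imp,
    forall_eq, heightForm_mul_sub] at hv
  rw [← heightPairing_conj z t (-α - k * p) _ p q] at hv
  simp [Complex.normSq_apply, GaussianInt.toComplex_def] at hv
  have hfl (x : ℝ) : 0 ≤ x - ⌊x / A⌋ * A ∧ x - ⌊x / A⌋ * A ≤ A := by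
    have h1 := Int.floor_le (x / A)
    have h2 := (Int.lt_floor_add_one (x / A)).le
    rw [le_div_iff₀ hA0] at h1
    rw [div_le_iff₀ hA0] at h2
    constructor <;> linarith
  have hb1 := hfl B.re
  have hd1 := hfl B.im
  rw [← hb] at hb1
  rw [← hd] at hd1
  simp only [octahedronGap]
  rw [← hA]
  generalize heightPairing z t (-α - k * p) (β - k * q) p q = B' at *
  generalize heightForm z t (-α - k * p) (β - k * q) = C at *
  rcases abs_cases (C - B'.re - B'.im) with h1 | h1 <;>
    rcases abs_cases (A - B'.re - B'.im) with h2 | h2 <;>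
    rcases abs_cases (B'.re - B'.im) with h3 | h3 <;> linarith

theorem continuousOn_octahedronGap (z : ℂ) (p q p' q' : GaussianInt) :
    ContinuousOn (fun t => octahedronGap z t p q p' q') (Set.Ioi 0) := by
  have hne (t : ℝ) (ht : t ∈ Set.Ioi (0 : ℝ)) : t ≠ 0 := ne_of_gt ht
  have hne' (t : ℝ) (ht : t ∈ Set.Ioi (0 : ℝ)) : (t : ℂ) ≠ 0 := by exact_mod_cast hne t ht
  have hf (p q : GaussianInt) : ContinuousOn (fun t => heightForm z t p q) (Set.Ioi 0) := by
    unfold heightForm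
    fun_prop (disch := assumption)
  have hp : ContinuousOn (fun t => heightPairing z t p' q' p q) (Set.Ioi 0) := by
    unfold heightPairing
    refine ContinuousOn.add (ContinuousOn.div (by fun_prop) (by fun_prop) hne') (by fun_prop)
  have hre := Complex.continuous_re.comp_continuousOn hp
  have him := Complex.continuous_im.comp_continuousOn hp
  exact (((((hf p q).add (hf p' q')).sub hre).sub him).sub (((hf p' q').sub hre).sub him).abs
    |>.sub (((hf p q).sub hre).sub him).abs).sub (hre.sub him).abs

theorem toComplex_sub_mul_ne_zero {z : ℂ} (hz : z ∉ gaussianRationals) {p q : GaussianInt}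
    (h : IsCoprime p q) : p.toComplex - q.toComplex * z ≠ 0 := by
  intro h0
  by_cases hq : q = 0
  · subst hq
    have : p = 0 := by simpa using h0
    subst this
    exact not_isCoprime_zero_zero h
  · have hq0 : q.toComplex ≠ 0 := by simpa using hq
    refine hz ?_
    rw [show z = p.toComplex / q.toComplex by field_simp; linear_combination -h0]
    exact toComplex_div_mem_gaussianRationals p q

open Filter Topology in
theorem tendsto_heightForm_atTop {z : ℂ} (hz : z ∉ gaussianRationals) {p q : GaussianInt}
    (h : IsCoprime p q) : Tendsto (fun t => heightForm z t p q) (𝓝[>] 0) atTop := by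
  have h1 : 0 < Complex.normSq (p.toComplex - q.toComplex * z) :=
    Complex.normSq_pos.2 (toComplex_sub_mul_ne_zero hz h)
  refine tendsto_atTop_mono' _ ?_ (tendsto_inv_nhdsGT_zero.const_mul_atTop h1)
  filter_upwards [self_mem_nhdsWithin] with t (ht : 0 < t)
  rw [heightForm, div_eq_mul_inv]
  have := mul_nonneg ht.le (Complex.normSq_nonneg q.toComplex)
  linarith

open Filter Topology in
/-- The vertical geodesic ending at an irrational `z` crosses faces of ideal octahedra at
arbitrarily small heights. -/
theorem exists_heightForm_le_two_div_sqrt_three {z : ℂ} (hz : z ∉ gaussianRationals) {r : ℝ}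
    (hr : 0 < r) : ∃ t, 0 < t ∧ t ≤ r ∧ ∃ p q : GaussianInt, IsCoprime p q ∧
      heightForm z t p q ≤ 2 / √3 := by
  by_contra! hcon
  obtain ⟨p, q, p', q', hdet, h0⟩ := exists_octahedronGap_nonneg z hr
  have hne (t : ℝ) (ht : 0 < t) (htr : t ≤ r) : octahedronGap z t p q p' q' ≠ 0 :=
    octahedronGap_ne_zero ht.ne' hdet fun w hw =>
      hcon t ht htr w.1 w.2 (isCoprime_of_mem_octahedronVertices hdet hw)
  have hnonneg (t : ℝ) (ht : 0 < t) (htr : t ≤ r) : 0 ≤ octahedronGap z t p q p' q' := by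
    by_contra! hlt
    obtain ⟨s, hs, hs0⟩ := intermediate_value_Icc htr
      ((continuousOn_octahedronGap z p q p' q').mono fun x hx => ht.trans_le hx.1) ⟨hlt.le, h0⟩
    exact hne s (ht.trans_le hs.1) hs.2 hs0
  have hev : ∀ᶠ t in 𝓝[>] (0 : ℝ), ∀ w ∈ octahedronVertices p q p' q',
      2 < heightForm z t w.1 w.2 := by
    have := (eventually_all_finite (octahedronVertices p q p' q').finite_toSet).2 fun w hw =>
      (tendsto_heightForm_atTop hz
        (isCoprime_of_mem_octahedronVertices hdet hw)).eventually_gt_atTop 2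
    exact this
  obtain ⟨t, ht, ht0, htr⟩ := (hev.and (Ioc_mem_nhdsGT hr)).exists
  obtain ⟨w, hw, hw2⟩ := exists_octahedronVertices_le_two ht0.ne' hdet (hnonneg t ht0 htr)
  exact (ht w hw).not_ge hw2

theorem infinite_goodApproximations {z : ℂ} (hz : z ∉ gaussianRationals) :
    (goodApproximations z (1 / √3)).Infinite := by
  intro hfin
  have hs : 0 < √3 := by positivity
  have hs2 : √3 ^ 2 = 3 := Real.sq_sqrt (by norm_num)
  have hs1 : 1 ≤ √3 := by nlinarith
  have hsle : 2 / √3 ≤ 2 := div_le_self (by norm_num) hs1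
  have hirr : ∀ x ∈ goodApproximations z (1 / √3), 0 < ‖z - x‖ := by
    rintro _ ⟨p, q, -, -, rfl, -⟩
    refine norm_pos_iff.2 fun h => hz ?_
    rw [sub_eq_zero.1 h]
    exact toComplex_div_mem_gaussianRationals p q
  obtain ⟨ε, hε, hmin⟩ : ∃ ε > 0, ∀ x ∈ goodApproximations z (1 / √3), ε ≤ ‖z - x‖ := by
    rcases (goodApproximations z (1 / √3)).eq_empty_or_nonempty with he | hne
    · exact ⟨1, one_pos, fun x hx => by rw [he] at hx; exact hx.elim⟩
    · obtain ⟨y, hy, hmin⟩ := Set.exists_min_image _ (fun x => ‖z - x‖) hfin hne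
      exact ⟨_, hirr y hy, hmin⟩
  obtain ⟨t, ht, htr, p, q, hpq, hle⟩ := exists_heightForm_le_two_div_sqrt_three hz
    (r := min (1 / 4) (ε ^ 2 / 4)) (by positivity)
  have ht1 := htr.trans (min_le_left _ _)
  have ht2 := htr.trans (min_le_right _ _)
  simp only [heightForm, Complex.normSq_eq_norm_sq] at hle
  set a := ‖p.toComplex - q.toComplex * z‖ with ha
  set n := ‖q.toComplex‖ with hn
  have hn0 : 0 ≤ t * n ^ 2 := by positivity
  have ha2 : a ^ 2 ≤ 2 * t := by
    rw [← div_le_iff₀ ht]; linarith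
  have hprod : a * n ≤ 1 / √3 := by
    have h1 : 2 * (a * n) ≤ a ^ 2 / t + t * n ^ 2 := by
      have : a ^ 2 / t + t * n ^ 2 - 2 * (a * n) = (a - t * n) ^ 2 / t := by field_simp; ring
      have : 0 ≤ (a - t * n) ^ 2 / t := by positivity
      linarith
    rw [le_div_iff₀ hs]
    rw [le_div_iff₀ hs] at hle
    nlinarith
  have hq : q ≠ 0 := by
    rintro rfl
    have hp : p ≠ 0 := by rintro rfl; exact not_isCoprime_zero_zero hpq
    have h1 := one_le_norm_toComplex hp
    have h2 : a = ‖p.toComplex‖ := by simp [ha]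
    nlinarith
  have hn1 : 1 ≤ n := one_le_norm_toComplex hq
  have hq0 : q.toComplex ≠ 0 := by simpa using hq
  have hdist : ‖z - p.toComplex / q.toComplex‖ = a / n := by
    rw [ha, hn, ← norm_div, ← norm_neg]
    congr 1
    field_simp
    ring
  have hmem : p.toComplex / q.toComplex ∈ goodApproximations z (1 / √3) := by
    refine ⟨p, q, hq, hpq, rfl, ?_⟩
    rw [hdist, ← hn, le_div_iff₀ (by positivity)]
    calc a / n * n ^ 2 = a * n := by field_simp
      _ ≤ _ := hprod
  have h1 := hmin _ hmem
  rw [hdist, le_div_iff₀ (by linarith)] at h1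
  have h2 : ε ≤ a := by nlinarith
  nlinarith

theorem mainTheorem11 :
    (∀ z : ℂ, z ∉ gaussianRationals → (goodApproximations z (1 / Real.sqrt 3)).Infinite) ∧
    IsLeast {C : ℝ | ∀ z : ℂ, z ∉ gaussianRationals → (goodApproximations z C).Infinite}
      (1 / Real.sqrt 3) ∧
    (1 + (Real.sqrt 3 : ℂ) * Complex.I) / 2 ∉ gaussianRationals ∧
    ∀ C : ℝ, C < 1 / Real.sqrt 3 →
      (goodApproximations ((1 + (Real.sqrt 3 : ℂ) * Complex.I) / 2) C).Finite := by
  refine ⟨fun z hz => infinite_goodApproximations hz,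
    ⟨fun z hz => infinite_goodApproximations hz, fun C hC => ?_⟩,
    sixthRoot_notMem_gaussianRationals, fun C hC => finite_goodApproximations_sixthRoot hC⟩
  by_contra! hlt
  exact hC _ sixthRoot_notMem_gaussianRationals (finite_goodApproximations_sixthRoot hlt)
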